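/- For a real random variable $X$ let $\|X\|_{\psi_2}=\inf\{t>0:\mathbb E\exp(X^2/t^2)\le 2\}$. For a symmetric positive semidefinite $d\times d$ matrix $S$ and $K\ge 0$, say that a random vector $x$ in $\mathbb R^d$ (or its law) is $\mathrm{subG}_K(S)$ if $\mathbb E[xx^{T}]=S$ and $\|\langle u,x\rangle\|_{\psi_2}\le K\sqrt{u^{T}Su}$ for all $u\in\mathbb R^d$ (for positive definite $S$: the whitened vector $S^{-1/2}x$ has sub-Gaussian norm at most $K$; no centering is assumed). **Theorem.** For every $K\ge 0$ there is a constant $C>0$, depending only on $K$, such that the following holds for all $d,n$ and every positive definite $\Sigma\in\mathbb R^{d\times d}$. Let $\upsilon_1,\dots,\upsilon_n$ be i.i.d. random vectors in $\mathbb R^d$ with a common law that is $\mathrm{subG}_K(\Sigma)$, let $\Upsilon\in\mathbb R^{n\times d}$ be the matrix with rows $\upsilon_i^{T}$, and let $\hat\Sigma=\frac1n\Upsilon^{T}\Upsilon$. 1. Let $\xi$ be a random vector in $\mathbb R^d$, independent of $\Upsilon$, that is $\mathrm{subG}_{K'}(\Sigma)$ for some $K'\ge 0$. Then, almost surely on the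 event that $\hat\Sigma$ is positive definite, the conditional law of $\tilde\xi=\hat\Sigma^{-1/2}\xi$ given $\Upsilon$ is $\mathrm{subG}_{K'}(\hat\Sigma^{-1/2}\Sigma\hat\Sigma^{-1/2})$. 2. For every $\eta\in(0,1)$ with $\sqrt n>C\big(\sqrt d+\sqrt{\log(1/\eta)}\big)$, with probability at least $1-2\eta$ the matrix $\hat\Sigma$ is positive definite and $$L\,\mathbf I\preceq\hat\Sigma^{-1/2}\Sigma\,\hat\Sigma^{-1/2}\preceq U\,\mathbf I,$$ where $$L=\frac{n}{\big(\sqrt n+C(\sqrt d+\sqrt{\log(1/\eta)})\big)^2},\qquad U=\frac{n}{\big(\sqrt n-C(\sqrt d+\sqrt{\log(1/\eta)})\big)^2}.$$ -/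

import Mathlib

open MeasureTheory ProbabilityTheory
open scoped ENNReal NNReal Matrix MatrixOrder

noncomputable section

namespace SecondMoment

/-- The sub-Gaussian (Orlicz) norm of a real random variable,
`‖X‖_ψ₂ = inf {t > 0 : 𝔼 exp (X² / t²) ≤ 2}`, with value `∞` if there is no such `t`. -/
def psi2Norm {Ω : Type*} [MeasurableSpace Ω] (X : Ω → ℝ) (μ : Measure Ω) : ℝ≥0∞ :=
  ⨅ (t : ℝ≥0) (_ : 0 < t)
    (_ : ∫⁻ ω, ENNReal.ofReal (Real.exp ((X ω / t) ^ 2)) ∂μ ≤ 2), (t : ℝ≥0∞)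

/-- `P` is a sub-Gaussian distribution `subG(S)` on `ℝᵈ`: its second-moment matrix `𝔼 x xᵀ` is `S`
and all one-dimensional marginals are sub-Gaussian. The number `K` bounds the sub-Gaussian norm
relative to `S`: `‖⟨u, x⟩‖_ψ₂ ≤ K √(uᵀ S u)` for all `u`. For positive definite `S` this says that
the whitened vector `S^{-1/2} x` has sub-Gaussian norm at most `K`. No centering is required. -/
structure IsSubG {d : ℕ} (K : ℝ≥0) (S : Matrix (Fin d) (Fin d) ℝ)
    (P : Measure (EuclideanSpace ℝ (Fin d))) : Prop where
  isProb : IsProbabilityMeasure P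
  integrable : ∀ i j, Integrable (fun x => x i * x j) P
  secondMoment : ∀ i j, ∫ x, x i * x j ∂P = S i j
  psi2Norm_le : ∀ u : EuclideanSpace ℝ (Fin d),
    psi2Norm (fun x => inner ℝ u x) P ≤ K * ENNReal.ofReal (√(u.ofLp ⬝ᵥ S *ᵥ u.ofLp))

/-- The empirical second-moment matrix `(1/n) ΥᵀΥ`, where `Υ` is the `n × d` matrix with
rows `v i`. -/
def empSecondMoment {n d : ℕ} (v : Fin n → EuclideanSpace ℝ (Fin d)) :
    Matrix (Fin d) (Fin d) ℝ :=
  (n : ℝ)⁻¹ • ((Matrix.of fun i j => v i j)ᵀ * Matrix.of fun i j => v i j)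

/-- The inverse square root `A^{-1/2}` of a positive definite matrix `A`. -/
def invSqrt {d : ℕ} (A : Matrix (Fin d) (Fin d) ℝ) : Matrix (Fin d) (Fin d) ℝ :=
  (CFC.sqrt A)⁻¹

/-- The matrix `A^{-1/2} S A^{-1/2}`. -/
def whiten {d : ℕ} (A S : Matrix (Fin d) (Fin d) ℝ) : Matrix (Fin d) (Fin d) ℝ :=
  invSqrt A * S * invSqrt A

/-- The lower bound `n / (√n + C (√d + √(log (1/η))))²`. -/
def lowerBound (C : ℝ) (n d : ℕ) (η : ℝ) : ℝ :=
  n / (√n + C * (√d + √(Real.log (1 / η)))) ^ 2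

/-- The upper bound `n / (√n - C (√d + √(log (1/η))))²`. -/
def upperBound (C : ℝ) (n d : ℕ) (η : ℝ) : ℝ :=
  n / (√n - C * (√d + √(Real.log (1 / η)))) ^ 2

end SecondMoment

end

/-! Conditional law: since `ξ` is independent of the sample, conditioning on `υ = v` only freezes
the matrix `invSqrt (empSecondMoment v)`. The conditional law is thus a linear image of the law of
`ξ`, and `IsSubG.map` transports the sub-Gaussian bound along linear maps.

Two-sided bound: applying `S^{-1/2}` to the sample reduces to `S = 1`. There `⟨x,w⟩⟨y,w⟩` is
sub-exponential for `x`, `y` in the unit ball, so Bernstein controls its empirical mean. A union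
bound over pairs from a `1/2`-net (at most `25 ^ d` pairs) makes `(1/n) ∑ w wᵀ - 1` of operator norm
at most `t`. Undoing the whitening gives `(1 - t) S ≤ Σ̂ ≤ (1 + t) S`, and congruence by `Σ̂^{-1/2}`
gives bounds `1/(1 ± t)`, which are sharper than the squared ones claimed. With `t = C (√d + √(log
(1/η))) / √n` the squared bounds are exactly `lowerBound` and `upperBound`. -/

namespace SecondMoment

/-! ### Linear images of sub-Gaussian laws and the conditional law of the whitened vector. -/

section Whitening

variable {n d : ℕ}

lemma empSecondMoment_posSemidef (v : Fin n → EuclideanSpace ℝ (Fin d)) :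
    (empSecondMoment v).PosSemidef := by
  unfold empSecondMoment
  refine Matrix.PosSemidef.smul ?_ (by positivity)
  simpa using! Matrix.posSemidef_conjTranspose_mul_self
    (Matrix.of fun i j => v i j : Matrix (Fin n) (Fin d) ℝ)

open scoped Matrix.Norms.L2Operator in
lemma continuous_sqrt_empSecondMoment :
    Continuous fun v : Fin n → EuclideanSpace ℝ (Fin d) => CFC.sqrt (empSecondMoment v) := by
  refine CFC.continuousOn_sqrt.comp_continuous ?_ fun v =>
    (empSecondMoment_posSemidef v).nonneg
  unfold empSecondMoment
  fun_prop

/-- Inversion is not continuous at singular matrices, but `det⁻¹ • adjugate` is measurable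
everywhere, with `0⁻¹ = 0`. -/
lemma measurable_invSqrt_empSecondMoment (i j : Fin d) :
    Measurable fun v : Fin n → EuclideanSpace ℝ (Fin d) => invSqrt (empSecondMoment v) i j := by
  have h := continuous_sqrt_empSecondMoment (n := n) (d := d)
  simp only [invSqrt, Matrix.inv_def, Ring.inverse_eq_inv', Matrix.smul_apply, smul_eq_mul]
  refine (h.matrix_det.measurable.inv).mul ?_
  exact (h.matrix_adjugate.matrix_elem i j).measurable

lemma invSqrt_isHermitian (A : Matrix (Fin d) (Fin d) ℝ) : (invSqrt A).IsHermitian := by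
  unfold invSqrt
  exact (Matrix.nonneg_iff_posSemidef.mp (CFC.sqrt_nonneg A)).isHermitian.inv

lemma invSqrt_transpose (A : Matrix (Fin d) (Fin d) ℝ) : (invSqrt A)ᵀ = invSqrt A := by
  simpa using! invSqrt_isHermitian A

lemma isUnit_sqrt {A : Matrix (Fin d) (Fin d) ℝ} (hA : A.PosDef) : IsUnit (CFC.sqrt A) := by
  have h : IsUnit (CFC.sqrt A * CFC.sqrt A) := by
    rw [CFC.sqrt_mul_sqrt_self A hA.posSemidef.nonneg]; exact hA.isUnit
  rw [Matrix.isUnit_iff_isUnit_det] at h ⊢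
  rw [Matrix.det_mul] at h
  exact isUnit_of_mul_isUnit_left h

lemma isUnit_invSqrt {A : Matrix (Fin d) (Fin d) ℝ} (hA : A.PosDef) : IsUnit (invSqrt A) :=
  (Matrix.isUnit_nonsing_inv_iff).mpr (isUnit_sqrt hA)

lemma whiten_self {A : Matrix (Fin d) (Fin d) ℝ} (hA : A.PosDef) : whiten A A = 1 := by
  have h := (Matrix.isUnit_iff_isUnit_det _).mp (isUnit_sqrt hA)
  have h2 := CFC.sqrt_mul_sqrt_self A hA.posSemidef.nonneg
  unfold whiten invSqrt
  calc (CFC.sqrt A)⁻¹ * A * (CFC.sqrt A)⁻¹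
      = (CFC.sqrt A)⁻¹ * (CFC.sqrt A * CFC.sqrt A) * (CFC.sqrt A)⁻¹ := by rw [h2]
    _ = 1 := by
      rw [← mul_assoc, Matrix.nonsing_inv_mul _ h, one_mul, Matrix.mul_nonsing_inv _ h]

lemma inner_toEuclideanLin (M : Matrix (Fin d) (Fin d) ℝ) (u x : EuclideanSpace ℝ (Fin d)) :
    inner ℝ u (Matrix.toEuclideanLin M x) = inner ℝ (Matrix.toEuclideanLin Mᵀ u) x := by
  rw [← Matrix.conjTranspose_eq_transpose_of_trivial, Matrix.toEuclideanLin_conjTranspose_eq_adjoint,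
    LinearMap.adjoint_inner_left]

/-- `⟨u, M x⟩ = ⟨Mᵀ u, x⟩`, and the form of `S` at `Mᵀ u` is the form of `M S Mᵀ` at `u`, so `K` is
unchanged. -/
lemma IsSubG.map {K : ℝ≥0} {S : Matrix (Fin d) (Fin d) ℝ}
    {P : Measure (EuclideanSpace ℝ (Fin d))} (h : IsSubG K S P) (M : Matrix (Fin d) (Fin d) ℝ) :
    IsSubG K (M * S * Mᵀ) (P.map (Matrix.toEuclideanLin M)) := by
  have := h.isProb
  have hm : Measurable (Matrix.toEuclideanLin M) :=
    (LinearMap.continuous_of_finiteDimensional _).measurable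
  have hexp : ∀ i j (x : EuclideanSpace ℝ (Fin d)),
      Matrix.toEuclideanLin M x i * Matrix.toEuclideanLin M x j
        = ∑ k, ∑ l, M i k * M j l * (x k * x l) := by
    intro i j x
    simp only [Matrix.ofLp_toLpLin, Matrix.toLin'_apply, Matrix.mulVec, dotProduct,
      Finset.sum_mul_sum]
    exact Finset.sum_congr rfl fun k _ => Finset.sum_congr rfl fun l _ => by ring
  have hint : ∀ i j, ∀ k ∈ Finset.univ, ∀ l ∈ Finset.univ,
      Integrable (fun x : EuclideanSpace ℝ (Fin d) => M i k * M j l * (x k * x l)) P :=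
    fun i j k _ l _ => (h.integrable k l).const_mul _
  refine ⟨Measure.isProbabilityMeasure_map hm.aemeasurable, fun i j => ?_, fun i j => ?_,
    fun u => ?_⟩
  · rw [integrable_map_measure (by fun_prop) hm.aemeasurable]
    simp only [Function.comp_def, hexp]
    exact integrable_finsetSum _ fun k hk => integrable_finsetSum _ (hint i j k hk)
  · rw [integral_map hm.aemeasurable (by fun_prop)]
    simp only [hexp]
    rw [integral_finsetSum _ fun k hk => integrable_finsetSum _ (hint i j k hk)]
    simp_rw [integral_finsetSum _ (hint i j _ (Finset.mem_univ _)), integral_const_mul,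
      h.secondMoment, Matrix.mul_apply, Finset.sum_mul, Matrix.transpose_apply]
    rw [Finset.sum_comm]
    exact Finset.sum_congr rfl fun k _ => Finset.sum_congr rfl fun l _ => by ring
  · have key := h.psi2Norm_le (Matrix.toEuclideanLin Mᵀ u)
    have e1 : psi2Norm (fun x => inner ℝ u x) (P.map (Matrix.toEuclideanLin M))
        = psi2Norm (fun x => inner ℝ (Matrix.toEuclideanLin Mᵀ u) x) P := by
      unfold psi2Norm
      refine iInf_congr fun t => iInf_congr fun _ => ?_
      rw [lintegral_map (by fun_prop) hm]
      simp only [inner_toEuclideanLin]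
    rw [e1]
    refine key.trans_eq ?_
    congr 3
    simp only [Matrix.ofLp_toLpLin, Matrix.toLin'_apply]
    rw [← Matrix.mulVec_mulVec, ← Matrix.mulVec_mulVec, Matrix.dotProduct_mulVec u.ofLp M,
      ← Matrix.mulVec_transpose]

theorem ae_isSubG_condDistrib_whiten {Ω : Type*} [MeasurableSpace Ω] {μ : Measure Ω}
    [IsProbabilityMeasure μ] {K : ℝ≥0} {S : Matrix (Fin d) (Fin d) ℝ}
    {υ : Ω → Fin n → EuclideanSpace ℝ (Fin d)} {ξ : Ω → EuclideanSpace ℝ (Fin d)}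
    (hυ : AEMeasurable υ μ) (hξ : AEMeasurable ξ μ) (hS : IsSubG K S (μ.map ξ))
    (hind : IndepFun ξ υ μ) :
    ∀ᵐ ω ∂μ, IsSubG K (whiten (empSecondMoment (υ ω)) S)
      (condDistrib (fun ω' => Matrix.toEuclideanLin (invSqrt (empSecondMoment (υ ω'))) (ξ ω'))
        υ μ (υ ω)) := by
  let f : (Fin n → EuclideanSpace ℝ (Fin d)) × EuclideanSpace ℝ (Fin d) →
      EuclideanSpace ℝ (Fin d) :=
    fun p => Matrix.toEuclideanLin (invSqrt (empSecondMoment p.1)) p.2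
  have hf : Measurable f := by
    refine (MeasurableEquiv.toLp 2 (Fin d → ℝ)).measurable.comp (measurable_pi_lambda _ fun i => ?_)
    change Measurable fun p : (Fin n → EuclideanSpace ℝ (Fin d)) × EuclideanSpace ℝ (Fin d) =>
      (invSqrt (empSecondMoment p.1) *ᵥ p.2.ofLp) i
    simp only [Matrix.mulVec, dotProduct]
    refine Finset.measurable_fun_sum _ fun j _ => ?_
    exact ((measurable_invSqrt_empSecondMoment i j).comp measurable_fst).mul (by fun_prop)
  have : IsProbabilityMeasure (μ.map ξ) := hS.isProb
  -- Candidate conditional law: the law of `f (v, ξ)` with `v` frozen. By a.e. uniqueness of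
  -- disintegrations, `hjoint` suffices to identify it.
  let κ : Kernel (Fin n → EuclideanSpace ℝ (Fin d)) (EuclideanSpace ℝ (Fin d)) :=
    (Kernel.id ×ₖ Kernel.const _ (μ.map ξ)).map f
  have : IsMarkovKernel κ := Kernel.IsMarkovKernel.map _ hf
  have hκ : ∀ v, κ v = (μ.map ξ).map (Matrix.toEuclideanLin (invSqrt (empSecondMoment v))) := by
    intro v
    rw [Kernel.map_apply _ hf, Kernel.prod_apply, Kernel.id_apply, Kernel.const_apply,
      Measure.dirac_prod, Measure.map_map hf (by fun_prop)]
    rfl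
  have hjoint : μ.map (fun ω => (υ ω, f (υ ω, ξ ω))) = μ.map υ ⊗ₘ κ := by
    have h1 := (indepFun_iff_map_prod_eq_prod_map_map hυ hξ).mp hind.symm
    have h2 : μ.map (fun ω => (υ ω, f (υ ω, ξ ω)))
        = ((μ.map υ).prod (μ.map ξ)).map (fun p => (p.1, f p)) := by
      rw [← h1, AEMeasurable.map_map_of_aemeasurable (by fun_prop) (by fun_prop)]
      rfl
    have := Measure.isProbabilityMeasure_map (μ := μ) hυ
    rw [h2]
    ext s hs
    rw [Measure.map_apply (by fun_prop) hs, Measure.prod_apply (by measurability),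
      Measure.compProd_apply hs]
    refine lintegral_congr fun v => ?_
    rw [hκ, Measure.map_apply (LinearMap.continuous_of_finiteDimensional _).measurable
      (measurable_prodMk_left hs)]
    rfl
  have h := condDistrib_ae_eq_of_measure_eq_compProd υ (Y := fun ω => f (υ ω, ξ ω))
    (by fun_prop) hjoint
  filter_upwards [ae_of_ae_map hυ h] with ω hω
  rw [hω, hκ]
  simpa only [whiten, invSqrt_transpose] using hS.map (invSqrt (empSecondMoment (υ ω)))

end Whitening

/-! ### Moment generating functions of sub-exponential variables and Bernstein's inequality. -/

section Bernstein

lemma exp_le_one_add_add_sq_mul_exp_abs (x : ℝ) :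
    Real.exp x ≤ 1 + x + x ^ 2 * Real.exp |x| := by
  have h := Complex.norm_exp_sub_sum_le_norm_mul_exp (x : ℂ) 2
  simp only [Finset.sum_range_succ, Finset.sum_range_zero, zero_add, pow_zero, pow_one,
    Nat.factorial, Nat.cast_one, div_one, mul_one] at h
  norm_cast at h
  rw [Real.norm_eq_abs, Real.norm_eq_abs, sq_abs] at h
  linarith [le_abs_self (Real.exp x - (1 + x))]

variable {Ω : Type*} [MeasurableSpace Ω] {μ : Measure Ω}

/-- A random variable with `𝔼 exp (|W| / b) ≤ 2` -/
structure IsSubExp (b : ℝ) (W : Ω → ℝ) (μ : Measure Ω) : Prop where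
  pos : 0 < b
  aemeasurable : AEMeasurable W μ
  integrable : Integrable (fun ω => Real.exp (|W ω| / b)) μ
  integral_le : ∫ ω, Real.exp (|W ω| / b) ∂μ ≤ 2

namespace IsSubExp

variable {b : ℝ} {W : Ω → ℝ}

lemma integrable_exp_mul (h : IsSubExp b W μ) {l : ℝ} (hl : |l| ≤ 1 / (2 * b)) :
    Integrable (fun ω => Real.exp (l * W ω)) μ := by
  have hb := h.pos
  have := h.aemeasurable
  refine h.integrable.mono' (by fun_prop) (ae_of_all _ fun ω => ?_)
  rw [Real.norm_of_nonneg (Real.exp_pos _).le]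
  refine Real.exp_le_exp.mpr ?_
  calc l * W ω ≤ |l| * |W ω| := by rw [← abs_mul]; exact le_abs_self _
    _ ≤ 1 / b * |W ω| := by
      gcongr
      refine hl.trans ?_
      gcongr
      linarith
    _ = |W ω| / b := by ring

/-- Half of the exponent `|W| / b` absorbs `exp |l W|`; the other half absorbs `W ^ 2` through `y ^
2 / 2 ≤ exp y`. -/
lemma exp_mul_le (h : IsSubExp b W μ) {l : ℝ} (hl : |l| ≤ 1 / (2 * b)) (ω : Ω) :
    Real.exp (l * W ω) ≤ 1 + l * W ω + 8 * b ^ 2 * l ^ 2 * Real.exp (|W ω| / b) := by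
  have hb := h.pos
  have h1 := exp_le_one_add_add_sq_mul_exp_abs (l * W ω)
  have h2 : Real.exp |l * W ω| ≤ Real.exp (|W ω| / (2 * b)) := by
    refine Real.exp_le_exp.mpr ?_
    rw [abs_mul]
    calc |l| * |W ω| ≤ 1 / (2 * b) * |W ω| := by gcongr
      _ = _ := by ring
  have h3 : (W ω) ^ 2 ≤ 8 * b ^ 2 * Real.exp (|W ω| / (2 * b)) := by
    have := Real.quadratic_le_exp_of_nonneg (x := |W ω| / (2 * b)) (by positivity)
    have h4 : (W ω) ^ 2 = 8 * b ^ 2 * ((|W ω| / (2 * b)) ^ 2 / 2) := by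
      rw [div_pow, sq_abs]; field_simp; ring
    rw [h4]
    have : 0 ≤ |W ω| / (2 * b) := by positivity
    gcongr
    linarith
  have h5 : Real.exp (|W ω| / b) = Real.exp (|W ω| / (2 * b)) * Real.exp (|W ω| / (2 * b)) := by
    rw [← Real.exp_add]; congr 1; field_simp; ring
  calc _ ≤ _ := h1
    _ ≤ 1 + l * W ω + l ^ 2 * (8 * b ^ 2 * Real.exp (|W ω| / (2 * b))) *
        Real.exp (|W ω| / (2 * b)) := by rw [mul_pow]; gcongr
    _ = _ := by rw [h5]; ring

lemma integrable_self (h : IsSubExp b W μ) : Integrable W μ := by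
  have hb := h.pos
  refine (h.integrable.const_mul b).mono' h.aemeasurable.aestronglyMeasurable
    (ae_of_all _ fun ω => ?_)
  have := Real.add_one_le_exp (|W ω| / b)
  calc ‖W ω‖ = b * (|W ω| / b) := by rw [Real.norm_eq_abs]; field_simp
    _ ≤ _ := by gcongr; linarith

lemma mgf_le [IsProbabilityMeasure μ] (h : IsSubExp b W μ) {l : ℝ} (hl : |l| ≤ 1 / (2 * b)) :
    mgf W μ l ≤ Real.exp (l * μ[W] + 16 * b ^ 2 * l ^ 2) := by
  have hW := h.integrable_self
  calc mgf W μ l ≤ ∫ ω, (1 + l * W ω + 8 * b ^ 2 * l ^ 2 * Real.exp (|W ω| / b)) ∂μ :=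
        integral_mono (h.integrable_exp_mul hl)
          (((integrable_const _).add (hW.const_mul _)).add (h.integrable.const_mul _))
          (h.exp_mul_le hl)
    _ = 1 + l * μ[W] + 8 * b ^ 2 * l ^ 2 * ∫ ω, Real.exp (|W ω| / b) ∂μ := by
      have h1 : Integrable (fun _ : Ω => (1 : ℝ)) μ := integrable_const _
      have h2 : Integrable (fun ω => 1 + l * W ω) μ := h1.add (hW.const_mul l)
      rw [integral_add h2 (h.integrable.const_mul _), integral_add h1 (hW.const_mul l),
        integral_const_mul, integral_const_mul]
      simp
    _ ≤ 1 + l * μ[W] + 8 * b ^ 2 * l ^ 2 * 2 := by gcongr; exact h.integral_le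
    _ = l * μ[W] + 16 * b ^ 2 * l ^ 2 + 1 := by ring
    _ ≤ _ := Real.add_one_le_exp _

lemma neg (h : IsSubExp b W μ) : IsSubExp b (fun ω => -W ω) μ :=
  ⟨h.pos, h.aemeasurable.neg, by simpa using h.integrable, by simpa using h.integral_le⟩

end IsSubExp

variable [IsProbabilityMeasure μ] {n : ℕ} {b m t : ℝ} {W : Fin n → Ω → ℝ}

/-- **Bernstein's inequality**, one-sided, in the sub-Gaussian range of deviations. -/
lemma measureReal_sum_ge_le (hW : ∀ i, IsSubExp b (W i) μ) (hm : ∀ i, μ[W i] = m)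
    (hind : iIndepFun W μ) (hb : 0 < b) (ht0 : 0 ≤ t) (ht : t ≤ 16 * b) :
    μ.real {ω | n * (m + t) ≤ ∑ i, W i ω} ≤ Real.exp (-(n * t ^ 2 / (64 * b ^ 2))) := by
  -- The minimiser of `16 b² l² - l t`; the constraint `l ≤ 1 / (2 b)` is exactly `t ≤ 16 b`.
  set l : ℝ := t / (32 * b ^ 2) with hldef
  have hl0 : 0 ≤ l := by positivity
  have hl : |l| ≤ 1 / (2 * b) := by
    rw [abs_of_nonneg hl0, hldef, div_le_div_iff₀ (by positivity) (by positivity)]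
    nlinarith
  have hmeas := fun i => (hW i).aemeasurable
  have hmgf := hind.mgf_sum₀ (t := l) hmeas Finset.univ
  have hle : mgf (∑ i, W i) μ l ≤ Real.exp (n * (l * m + 16 * b ^ 2 * l ^ 2)) := by
    rw [hmgf, Real.exp_nat_mul]
    calc ∏ i, mgf (W i) μ l ≤ ∏ _i : Fin n, Real.exp (l * m + 16 * b ^ 2 * l ^ 2) :=
          Finset.prod_le_prod (fun _ _ => mgf_nonneg) fun i _ => by
            simpa only [hm i] using (hW i).mgf_le hl
      _ = _ := by simp
  have hint : Integrable (fun ω => Real.exp (l * (∑ i, W i) ω)) μ := by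
    -- A non-integrable exponential would have `mgf` equal to the default value `0`, so positivity
    -- of the product gives integrability.
    refine mgf_pos_iff.mp ?_
    rw [hmgf]
    exact Finset.prod_pos fun i _ => mgf_pos ((hW i).integrable_exp_mul hl)
  have h := measure_ge_le_exp_mul_mgf (X := ∑ i, W i) (n * (m + t)) hl0 hint
  simp only [Finset.sum_apply] at h
  refine h.trans ?_
  calc _ ≤ Real.exp (-l * (n * (m + t))) * Real.exp (n * (l * m + 16 * b ^ 2 * l ^ 2)) := by gcongr
    _ = _ := by
      rw [← Real.exp_add, hldef]
      congr 1
      field_simp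
      ring

lemma measureReal_abs_sum_ge_le (hW : ∀ i, IsSubExp b (W i) μ) (hm : ∀ i, μ[W i] = m)
    (hind : iIndepFun W μ) (hb : 0 < b) (ht0 : 0 ≤ t) (ht : t ≤ 16 * b) :
    μ.real {ω | n * t ≤ |∑ i, W i ω - n * m|} ≤ 2 * Real.exp (-(n * t ^ 2 / (64 * b ^ 2))) := by
  have h1 := measureReal_sum_ge_le hW hm hind hb ht0 ht
  have h2 := measureReal_sum_ge_le (W := fun i ω => -W i ω) (m := -m) (fun i => (hW i).neg)
    (fun i => by rw [integral_neg, hm i]) (hind.comp (fun _ x => -x) fun _ => measurable_neg)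
    hb ht0 ht
  calc _ ≤ μ.real ({ω | n * (m + t) ≤ ∑ i, W i ω} ∪ {ω | n * (-m + t) ≤ ∑ i, -W i ω}) := by
        refine measureReal_mono fun ω hω => ?_
        rcases le_abs.mp (show n * t ≤ |∑ i, W i ω - n * m| from hω) with h | h
        · left; rw [Set.mem_ofPred_eq]; linarith
        · right; rw [Set.mem_ofPred_eq, Finset.sum_neg_distrib]; linarith
    _ ≤ _ := measureReal_union_le _ _
    _ ≤ _ := by linarith

end Bernstein

/-! ### Nets of the unit ball and operator norms. -/

section Net

variable {E : Type*} [NormedAddCommGroup E] [InnerProductSpace ℝ E]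

variable (E) in
/-- The unit ball has a `1/2`-net with at most `5 ^ d` points. -/
lemma exists_half_net [FiniteDimensional ℝ E] : ∃ N : Finset E, (∀ x ∈ N, ‖x‖ ≤ 1) ∧ N.card ≤ 5 ^ Module.finrank ℝ E ∧
    ∀ u : E, ‖u‖ ≤ 1 → ∃ x ∈ N, ‖u - x‖ ≤ 1 / 2 := by
  classical
  have hcard : ∀ N : Finset E, (∀ x ∈ N, ‖x‖ ≤ 1) →
      (∀ x ∈ N, ∀ y ∈ N, x ≠ y → 1 / 2 ≤ ‖x - y‖) → N.card ≤ 5 ^ Module.finrank ℝ E := by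
    intro N h1 h2
    -- Doubling matches the normalisation of the Besicovitch bound: radius `2`, separation `1`.
    have hinj : Function.Injective fun x : E => (2 : ℝ) • x := smul_right_injective E two_ne_zero
    rw [← Finset.card_image_of_injective N hinj]
    refine Besicovitch.card_le_of_separated _ ?_ ?_
    · simp only [Finset.forall_mem_image, norm_smul, Real.norm_ofNat]
      exact fun x hx => by linarith [h1 x hx]
    · simp only [Finset.forall_mem_image]
      intro x hx y hy hxy
      rw [← smul_sub, norm_smul, Real.norm_ofNat]
      linarith [h2 x hx y hy (fun h => hxy (by rw [h]))]
  by_contra! hcon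
  -- Without a net, a separated set could always be enlarged by a far point, eventually violating
  -- `hcard`.
  have key : ∀ k : ℕ, ∃ N : Finset E, (∀ x ∈ N, ‖x‖ ≤ 1) ∧
      (∀ x ∈ N, ∀ y ∈ N, x ≠ y → 1 / 2 ≤ ‖x - y‖) ∧ N.card = k := by
    intro k
    induction k with
    | zero => exact ⟨∅, by simp⟩
    | succ k ih =>
      obtain ⟨N, h1, h2, rfl⟩ := ih
      obtain ⟨u, hu, hfar⟩ := hcon N h1 (hcard N h1 h2)
      have hmem : u ∉ N := fun h => by
        have := hfar u h
        rw [sub_self, norm_zero] at this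
        norm_num at this
      refine ⟨insert u N, ?_, ?_, Finset.card_insert_of_notMem hmem⟩
      · simpa [Finset.forall_mem_insert] using ⟨hu, h1⟩
      · intro x hx y hy hxy
        rcases Finset.mem_insert.mp hx with rfl | hxN <;>
          rcases Finset.mem_insert.mp hy with rfl | hyN
        · exact absurd rfl hxy
        · exact (hfar y hyN).le
        · rw [norm_sub_rev]; exact (hfar x hxN).le
        · exact h2 x hxN y hyN hxy
  obtain ⟨N, h1, h2, h3⟩ := key (5 ^ Module.finrank ℝ E + 1)
  have := hcard N h1 h2
  omega

/-- An operator that is small on a `1/2`-net, tested against the same net, is small. -/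
lemma opNorm_le_of_half_net {N : Finset E} (hN : ∀ u : E, ‖u‖ ≤ 1 → ∃ x ∈ N, ‖u - x‖ ≤ 1 / 2)
    (T : E →L[ℝ] E) {c : ℝ} (hT : ∀ x ∈ N, ∀ y ∈ N, |inner ℝ x (T y)| ≤ c) : ‖T‖ ≤ 4 * c := by
  obtain ⟨x₀, hx₀, -⟩ := hN 0 (by simp)
  have hc : 0 ≤ c := (abs_nonneg _).trans (hT x₀ hx₀ x₀ hx₀)
  -- Replacing the direction of `T y` by a net point loses at most half of `‖T y‖`; replacing `u`
  -- below loses half of `‖T‖`. Each costs a factor `2`.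
  have h1 : ∀ y ∈ N, ‖T y‖ ≤ 2 * c := by
    intro y hy
    rcases eq_or_ne (T y) 0 with h0 | h0
    · rw [h0, norm_zero]; positivity
    have hpos := norm_pos_iff.mpr h0
    obtain ⟨x, hx, hux⟩ := hN (‖T y‖⁻¹ • T y) (by rw [norm_smul, norm_inv, norm_norm]; field_simp; rfl)
    have e : ‖T y‖ = inner ℝ x (T y) + inner ℝ (‖T y‖⁻¹ • T y - x) (T y) := by
      rw [← inner_add_left, add_sub_cancel, real_inner_smul_left, real_inner_self_eq_norm_sq]
      field_simp
    have h2 := real_inner_le_norm (‖T y‖⁻¹ • T y - x) (T y)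
    have h3 := (le_abs_self _).trans (hT x hx y hy)
    have h4 : ‖‖T y‖⁻¹ • T y - x‖ * ‖T y‖ ≤ 1 / 2 * ‖T y‖ := by gcongr
    linarith
  have h2 : ‖T‖ ≤ 2 * c + ‖T‖ / 2 := by
    refine T.opNorm_le_of_unit_norm (by positivity) fun u hu => ?_
    obtain ⟨y, hy, huy⟩ := hN u hu.le
    calc ‖T u‖ = ‖T y + T (u - y)‖ := by rw [← map_add, add_sub_cancel]
      _ ≤ ‖T y‖ + ‖T (u - y)‖ := norm_add_le _ _
      _ ≤ 2 * c + ‖T‖ * (1 / 2) := by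
        gcongr
        · exact h1 y hy
        · exact (T.le_opNorm _).trans (by gcongr)
      _ = _ := by ring
  linarith

end Net

/-! ### From sub-Gaussian marginals to sub-exponential products. -/

section SubG

variable {d : ℕ}

lemma lintegral_exp_sq_div_le_of_psi2Norm_lt {Ω : Type*} [MeasurableSpace Ω] {μ : Measure Ω}
    {X : Ω → ℝ} {a : ℝ≥0} (h : psi2Norm X μ < a) :
    ∫⁻ ω, ENNReal.ofReal (Real.exp ((X ω / a) ^ 2)) ∂μ ≤ 2 := by
  simp only [psi2Norm, iInf_lt_iff] at h
  obtain ⟨t, ht, hint, hlt⟩ := h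
  refine (lintegral_mono fun ω => ENNReal.ofReal_le_ofReal (Real.exp_le_exp.mpr ?_)).trans hint
  have hta : (t : ℝ) ≤ a := by exact_mod_cast hlt.le
  have ht' : (0 : ℝ) < t := ht
  rw [div_pow, div_pow]
  gcongr

namespace IsSubG

variable {K : ℝ≥0} {S : Matrix (Fin d) (Fin d) ℝ} {P : Measure (EuclideanSpace ℝ (Fin d))}

lemma integral_inner_mul_inner (h : IsSubG K S P) (u v : EuclideanSpace ℝ (Fin d)) :
    ∫ x, inner ℝ u x * inner ℝ v x ∂P = u.ofLp ⬝ᵥ S *ᵥ v.ofLp := by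
  have hexp : ∀ x : EuclideanSpace ℝ (Fin d), inner ℝ u x * inner ℝ v x
      = ∑ i, ∑ j, u i * v j * (x i * x j) := by
    intro x
    simp only [PiLp.inner_apply, Finset.sum_mul_sum]
    refine Finset.sum_congr rfl fun i _ => Finset.sum_congr rfl fun j _ => ?_
    simp
    ring
  have hint : ∀ i, ∀ j ∈ Finset.univ,
      Integrable (fun x : EuclideanSpace ℝ (Fin d) => u i * v j * (x i * x j)) P :=
    fun i j _ => (h.integrable i j).const_mul _
  simp only [hexp]
  rw [integral_finsetSum _ fun i _ => integrable_finsetSum _ (hint i)]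
  simp_rw [integral_finsetSum _ (hint _), integral_const_mul, h.secondMoment, dotProduct,
    Matrix.mulVec, dotProduct, Finset.mul_sum]
  exact Finset.sum_congr rfl fun i _ => Finset.sum_congr rfl fun j _ => by ring

/-- Using `K + 1` makes the inequality for `psi2Norm` strict, so attainment of the infimum is never
needed and `K = 0` is covered. -/
lemma lintegral_exp_sq_inner_le (h : IsSubG K 1 P) {u : EuclideanSpace ℝ (Fin d)}
    (hu : ‖u‖ ≤ 1) :
    ∫⁻ x, ENNReal.ofReal (Real.exp ((inner ℝ u x / (K + 1)) ^ 2)) ∂P ≤ 2 := by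
  have h1 : psi2Norm (fun x => inner ℝ u x) P < ((K + 1 : ℝ≥0) : ℝ≥0∞) := by
    refine (h.psi2Norm_le u).trans_lt ?_
    have h2 : √(u.ofLp ⬝ᵥ (1 : Matrix (Fin d) (Fin d) ℝ) *ᵥ u.ofLp) = ‖u‖ := by
      rw [Matrix.one_mulVec, EuclideanSpace.norm_eq]
      simp [dotProduct, sq]
    rw [h2]
    calc (K : ℝ≥0∞) * ENNReal.ofReal ‖u‖ ≤ K * 1 := by
          gcongr
          exact ENNReal.ofReal_le_one.mpr hu
      _ < _ := by
          rw [mul_one]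
          exact_mod_cast lt_add_one K
  simpa using lintegral_exp_sq_div_le_of_psi2Norm_lt h1

lemma isSubExp_inner_mul_inner (h : IsSubG K 1 P) {u v : EuclideanSpace ℝ (Fin d)}
    (hu : ‖u‖ ≤ 1) (hv : ‖v‖ ≤ 1) :
    IsSubExp ((K + 1) ^ 2) (fun x => inner ℝ u x * inner ℝ v x) P := by
  set a : ℝ := K + 1 with ha_def
  have ha : 0 < a := by positivity
  have hint : ∀ w : EuclideanSpace ℝ (Fin d), ‖w‖ ≤ 1 →
      Integrable (fun x => Real.exp ((inner ℝ w x / a) ^ 2)) P ∧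
        ∫ x, Real.exp ((inner ℝ w x / a) ^ 2) ∂P ≤ 2 := by
    intro w hw
    have hle := h.lintegral_exp_sq_inner_le hw
    have hi : Integrable (fun x => Real.exp ((inner ℝ w x / a) ^ 2)) P :=
      ⟨by fun_prop, by
        rw [hasFiniteIntegral_iff_ofReal (ae_of_all _ fun _ => (Real.exp_pos _).le)]
        exact hle.trans_lt (by simp)⟩
    refine ⟨hi, ?_⟩
    rw [integral_eq_lintegral_of_nonneg_ae (ae_of_all _ fun _ => (Real.exp_pos _).le) (by fun_prop)]
    exact ENNReal.toReal_le_of_le_ofReal (by norm_num) (by simpa using hle)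
  -- AM-GM twice: in the exponent, then for the two exponentials.
  have hpt : ∀ x : EuclideanSpace ℝ (Fin d), Real.exp (|inner ℝ u x * inner ℝ v x| / a ^ 2)
      ≤ (Real.exp ((inner ℝ u x / a) ^ 2) + Real.exp ((inner ℝ v x / a) ^ 2)) / 2 := by
    intro x
    have h1 : |inner ℝ u x * inner ℝ v x| / a ^ 2 = |inner ℝ u x / a| * |inner ℝ v x / a| := by
      rw [← abs_mul, div_mul_div_comm, abs_div, ← sq, abs_of_pos (pow_pos ha 2)]
    rw [h1]
    generalize inner ℝ u x / a = p
    generalize inner ℝ v x / a = q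
    have h2 : Real.exp (|p| * |q|) ≤ Real.exp (p ^ 2 / 2) * Real.exp (q ^ 2 / 2) := by
      rw [← Real.exp_add]
      refine Real.exp_le_exp.mpr ?_
      nlinarith [sq_nonneg (|p| - |q|), sq_abs p, sq_abs q]
    have h3 : ∀ r : ℝ, Real.exp (r ^ 2) = Real.exp (r ^ 2 / 2) ^ 2 := fun r => by
      rw [← Real.exp_nat_mul]; congr 1; push_cast; ring
    rw [h3 p, h3 q]
    nlinarith [sq_nonneg (Real.exp (p ^ 2 / 2) - Real.exp (q ^ 2 / 2))]
  have hdom := ((hint u hu).1.add (hint v hv).1).div_const 2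
  have hi : Integrable (fun x => Real.exp (|inner ℝ u x * inner ℝ v x| / a ^ 2)) P :=
    hdom.mono' (by fun_prop) (ae_of_all _ fun x => by
      rw [Real.norm_of_nonneg (Real.exp_pos _).le]; exact hpt x)
  refine ⟨by positivity, by fun_prop, hi, ?_⟩
  refine (integral_mono hi hdom hpt).trans ?_
  have h1 := (hint u hu).2
  have h2 := (hint v hv).2
  rw [integral_div]
  simp only [Pi.add_apply]
  rw [integral_add (hint u hu).1 (hint v hv).1]
  linarith

end IsSubG

end SubG

/-! ### Uniform concentration for isotropic samples. -/

section Concentration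

variable {Ω : Type*} [MeasurableSpace Ω] {μ : Measure Ω} {d n : ℕ} {K : ℝ≥0}

lemma IsSubExp.comp_hasLaw {𝓧 : Type*} [MeasurableSpace 𝓧] {P : Measure 𝓧} {b : ℝ} {W : 𝓧 → ℝ}
    {X : Ω → 𝓧} (h : IsSubExp b W P) (hX : HasLaw X P μ) :
    IsSubExp b (fun ω => W (X ω)) μ := by
  have hi := h.integrable
  have hl := h.integral_le
  have hm := h.aemeasurable
  rw [← hX.map_eq] at hi hl hm
  have he : AEStronglyMeasurable (fun x => Real.exp (|W x| / b)) (μ.map X) := by fun_prop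
  rw [integrable_map_measure he hX.aemeasurable] at hi
  rw [integral_map hX.aemeasurable he] at hl
  exact ⟨h.pos, hm.comp_aemeasurable hX.aemeasurable, hi, hl⟩

/-- The deterministic half of the net argument; `t / 4` pays for the factor `4` in
`opNorm_le_of_half_net`. -/
lemma abs_empirical_sub_le_of_half_net {E : Type*} [NormedAddCommGroup E] [InnerProductSpace ℝ E]
    {N : Finset E} (hN : ∀ u : E, ‖u‖ ≤ 1 → ∃ x ∈ N, ‖u - x‖ ≤ 1 / 2) (w : Fin n → E) {t : ℝ}
    (hn : 0 < n)
    (h : ∀ x ∈ N, ∀ y ∈ N,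
      |∑ i, inner ℝ x (w i) * inner ℝ y (w i) - n * inner ℝ x y| ≤ n * (t / 4)) (u : E) :
    |(n : ℝ)⁻¹ * ∑ i, inner ℝ u (w i) ^ 2 - ‖u‖ ^ 2| ≤ t * ‖u‖ ^ 2 := by
  have hn' : (0 : ℝ) < n := by exact_mod_cast hn
  let T : E →L[ℝ] E :=
    (n : ℝ)⁻¹ • ∑ i, (innerSL ℝ (w i)).smulRight (w i) - ContinuousLinearMap.id ℝ E
  have hT : ∀ x y, inner ℝ x (T y)
      = (n : ℝ)⁻¹ * (∑ i, inner ℝ x (w i) * inner ℝ y (w i) - n * inner ℝ x y) := by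
    intro x y
    simp only [T, sub_apply, smul_apply,
      sum_apply, ContinuousLinearMap.smulRight_apply, innerSL_apply_apply,
      ContinuousLinearMap.id_apply, inner_sub_right, inner_smul_right, inner_sum]
    rw [mul_sub, inv_mul_cancel_left₀ hn'.ne']
    congr 2
    exact Finset.sum_congr rfl fun i _ => by rw [real_inner_comm (w i) y]; ring
  have hop : ‖T‖ ≤ 4 * (t / 4) := opNorm_le_of_half_net hN T fun x hx y hy => by
    rw [hT, abs_mul, abs_of_pos (inv_pos.mpr hn'), inv_mul_le_iff₀ hn']
    exact h x hx y hy
  have e : (n : ℝ)⁻¹ * ∑ i, inner ℝ u (w i) ^ 2 - ‖u‖ ^ 2 = inner ℝ u (T u) := by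
    rw [hT, mul_sub, inv_mul_cancel_left₀ hn'.ne', real_inner_self_eq_norm_sq]
    simp only [sq]
  rw [e]
  calc |inner ℝ u (T u)| ≤ ‖u‖ * ‖T u‖ := abs_real_inner_le_norm _ _
    _ ≤ ‖u‖ * (‖T‖ * ‖u‖) := by gcongr; exact T.le_opNorm u
    _ ≤ ‖u‖ * (4 * (t / 4) * ‖u‖) := by gcongr
    _ = _ := by ring

/-- Concentration of the empirical second moments of an isotropic sub-Gaussian sample, uniformly
over all directions. -/
theorem exists_measurableSet_forall_abs_empirical_sub_le [IsProbabilityMeasure μ]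
    {P : Measure (EuclideanSpace ℝ (Fin d))} (hP : IsSubG K 1 P)
    {w : Fin n → Ω → EuclideanSpace ℝ (Fin d)} (hw : ∀ i, HasLaw (w i) P μ)
    (hind : iIndepFun w μ) (hn : 0 < n) {t : ℝ} (ht0 : 0 ≤ t) (ht1 : t ≤ 1) :
    ∃ E : Set Ω, MeasurableSet E ∧
      1 - 2 * (25 ^ d * Real.exp (-(n * t ^ 2 / (1024 * ((K : ℝ) + 1) ^ 4)))) ≤ μ.real E ∧
      ∀ ω ∈ E, ∀ u : EuclideanSpace ℝ (Fin d),
        |(n : ℝ)⁻¹ * ∑ i, inner ℝ u (w i ω) ^ 2 - ‖u‖ ^ 2| ≤ t * ‖u‖ ^ 2 := by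
  obtain ⟨N, hN1, hNcard, hN⟩ := exists_half_net (EuclideanSpace ℝ (Fin d))
  rw [finrank_euclideanSpace_fin] at hNcard
  have hK : (1 : ℝ) ≤ (K + 1) ^ 2 := one_le_pow₀ (by linarith [K.coe_nonneg])
  let bad (p : EuclideanSpace ℝ (Fin d) × EuclideanSpace ℝ (Fin d)) : Set Ω :=
    {ω | n * (t / 4) ≤ |∑ i, inner ℝ p.1 (w i ω) * inner ℝ p.2 (w i ω) - n * inner ℝ p.1 p.2|}
  have hbad : ∀ p ∈ N ×ˢ N,
      μ.real (bad p) ≤ 2 * Real.exp (-(n * t ^ 2 / (1024 * ((K : ℝ) + 1) ^ 4))) := by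
    intro p hp
    obtain ⟨hp1, hp2⟩ := Finset.mem_product.mp hp
    have hse := hP.isSubExp_inner_mul_inner (hN1 _ hp1) (hN1 _ hp2)
    refine (measureReal_abs_sum_ge_le (W := fun i ω => inner ℝ p.1 (w i ω) * inner ℝ p.2 (w i ω))
      (fun i => hse.comp_hasLaw (hw i)) (fun i => ?_)
      (hind.comp (fun _ x => inner ℝ p.1 x * inner ℝ p.2 x) fun _ => by fun_prop)
      (lt_of_lt_of_le one_pos hK) (by positivity) (by linarith)).trans_eq ?_
    · rw [← integral_map (f := fun x => inner ℝ p.1 x * inner ℝ p.2 x) (hw i).aemeasurable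
        (by fun_prop), (hw i).map_eq, hP.integral_inner_mul_inner, Matrix.one_mulVec,
        EuclideanSpace.inner_eq_star_dotProduct, dotProduct_comm]
      simp
    -- The constant `1024` is `64 * 4 ^ 2`, from deviation `t / 4` at scale `b = (K + 1) ^ 2`.
    · congr 3
      field_simp
      ring
  set B : Set Ω := ⋃ p ∈ N ×ˢ N, bad p with hB
  have hBle : μ.real B ≤ 2 * (25 ^ d * Real.exp (-(n * t ^ 2 / (1024 * ((K : ℝ) + 1) ^ 4)))) := by
    calc μ.real B ≤ ∑ p ∈ N ×ˢ N, μ.real (bad p) := measureReal_biUnion_finset_le _ _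
      _ ≤ (N ×ˢ N).card • (2 * Real.exp (-(n * t ^ 2 / (1024 * ((K : ℝ) + 1) ^ 4)))) :=
        Finset.sum_le_card_nsmul _ _ _ hbad
      _ = ((N.card * N.card : ℕ) : ℝ) *
          (2 * Real.exp (-(n * t ^ 2 / (1024 * ((K : ℝ) + 1) ^ 4)))) := by
        rw [nsmul_eq_mul, Finset.card_product]
      _ ≤ 25 ^ d * (2 * Real.exp (-(n * t ^ 2 / (1024 * ((K : ℝ) + 1) ^ 4)))) := by
        gcongr
        have : N.card * N.card ≤ 5 ^ d * 5 ^ d := Nat.mul_le_mul hNcard hNcard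
        rw [← mul_pow] at this
        exact_mod_cast this
      _ = _ := by ring
  -- The `w i` are only a.e. measurable, so `B` is replaced by a measurable hull of the same
  -- measure.
  refine ⟨(toMeasurable μ B)ᶜ, (measurableSet_toMeasurable μ B).compl, ?_, fun ω hω => ?_⟩
  · rw [probReal_compl_eq_one_sub (measurableSet_toMeasurable μ B), measureReal_def,
      measure_toMeasurable, ← measureReal_def]
    linarith
  · refine abs_empirical_sub_le_of_half_net hN (fun i => w i ω) hn fun x hx y hy => ?_
    by_contra! hlt
    exact hω (subset_toMeasurable μ B
      (Set.mem_biUnion (Finset.mk_mem_product hx hy) (show ω ∈ bad (x, y) from hlt.le)))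

end Concentration

/-! ### Transfer of quadratic form bounds to the whitened matrix. -/

section Loewner

variable {n d : ℕ}

lemma dotProduct_empSecondMoment_mulVec (v : Fin n → EuclideanSpace ℝ (Fin d))
    (z : EuclideanSpace ℝ (Fin d)) :
    z.ofLp ⬝ᵥ empSecondMoment v *ᵥ z.ofLp = (n : ℝ)⁻¹ * ∑ i, inner ℝ z (v i) ^ 2 := by
  unfold empSecondMoment
  rw [Matrix.smul_mulVec, dotProduct_smul, smul_eq_mul, ← Matrix.mulVec_mulVec,
    Matrix.dotProduct_mulVec, Matrix.vecMul_transpose]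
  congr 1
  simp only [dotProduct, Matrix.mulVec, Matrix.of_apply]
  refine Finset.sum_congr rfl fun i _ => ?_
  rw [← sq, PiLp.inner_apply]
  simp

lemma dotProduct_whiten_mulVec (A S : Matrix (Fin d) (Fin d) ℝ) (u : Fin d → ℝ) :
    u ⬝ᵥ whiten A S *ᵥ u = (invSqrt A *ᵥ u) ⬝ᵥ S *ᵥ (invSqrt A *ᵥ u) := by
  unfold whiten
  rw [← Matrix.mulVec_mulVec, ← Matrix.mulVec_mulVec, Matrix.dotProduct_mulVec u,
    ← Matrix.mulVec_transpose, invSqrt_transpose]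

lemma whiten_isHermitian (A : Matrix (Fin d) (Fin d) ℝ) {S : Matrix (Fin d) (Fin d) ℝ}
    (hS : S.IsHermitian) : (whiten A S).IsHermitian := by
  have h := Matrix.isHermitian_mul_mul_conjTranspose (invSqrt A) hS
  rwa [(invSqrt_isHermitian A).eq] at h

lemma posDef_of_mul_le {A S : Matrix (Fin d) (Fin d) ℝ} (hS : S.PosDef) (hA : A.IsHermitian)
    {r : ℝ} (hr : 0 < r) (h : ∀ z : Fin d → ℝ, r * (z ⬝ᵥ S *ᵥ z) ≤ z ⬝ᵥ A *ᵥ z) : A.PosDef := by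
  refine Matrix.PosDef.of_dotProduct_mulVec_pos hA fun z hz => ?_
  have := hS.dotProduct_mulVec_pos hz
  simp only [star_trivial] at this ⊢
  exact (mul_pos hr this).trans_le (h z)

/-- Test the hypothesis at `z = A^{-1/2} u`, where the form of `A` becomes `u ⬝ᵥ u`. -/
lemma smul_one_le_whiten {A S : Matrix (Fin d) (Fin d) ℝ} (hA : A.PosDef) (hS : S.IsHermitian)
    {l : ℝ} (h : ∀ z : Fin d → ℝ, l * (z ⬝ᵥ A *ᵥ z) ≤ z ⬝ᵥ S *ᵥ z) :
    l • (1 : Matrix (Fin d) (Fin d) ℝ) ≤ whiten A S := by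
  rw [Matrix.le_iff]
  refine Matrix.PosSemidef.of_dotProduct_mulVec_nonneg
    ((whiten_isHermitian A hS).sub (Matrix.isHermitian_one.smul (IsSelfAdjoint.all _))) fun u => ?_
  have h1 := h (invSqrt A *ᵥ u)
  rw [← dotProduct_whiten_mulVec, ← dotProduct_whiten_mulVec, whiten_self hA] at h1
  rw [star_trivial, Matrix.sub_mulVec, dotProduct_sub, Matrix.smul_mulVec, dotProduct_smul,
    smul_eq_mul]
  linarith

lemma whiten_le_smul_one {A S : Matrix (Fin d) (Fin d) ℝ} (hA : A.PosDef) (hS : S.IsHermitian)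
    {r : ℝ} (h : ∀ z : Fin d → ℝ, z ⬝ᵥ S *ᵥ z ≤ r * (z ⬝ᵥ A *ᵥ z)) :
    whiten A S ≤ r • (1 : Matrix (Fin d) (Fin d) ℝ) := by
  rw [Matrix.le_iff]
  refine Matrix.PosSemidef.of_dotProduct_mulVec_nonneg
    ((Matrix.isHermitian_one.smul (IsSelfAdjoint.all _)).sub (whiten_isHermitian A hS)) fun u => ?_
  have h1 := h (invSqrt A *ᵥ u)
  rw [← dotProduct_whiten_mulVec, ← dotProduct_whiten_mulVec, whiten_self hA] at h1
  rw [star_trivial, Matrix.sub_mulVec, dotProduct_sub, Matrix.smul_mulVec, dotProduct_smul,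
    smul_eq_mul]
  linarith

/-- A relative bound on the quadratic form of the whitened sample, stated for the sample itself. -/
lemma abs_empSecondMoment_sub_le {S : Matrix (Fin d) (Fin d) ℝ} (hS : S.PosDef)
    (v : Fin n → EuclideanSpace ℝ (Fin d)) {t : ℝ}
    (h : ∀ u : EuclideanSpace ℝ (Fin d),
      |(n : ℝ)⁻¹ * ∑ i, inner ℝ u (Matrix.toEuclideanLin (invSqrt S) (v i)) ^ 2 - ‖u‖ ^ 2|
        ≤ t * ‖u‖ ^ 2) (z : Fin d → ℝ) :
    |z ⬝ᵥ empSecondMoment v *ᵥ z - z ⬝ᵥ S *ᵥ z| ≤ t * (z ⬝ᵥ S *ᵥ z) := by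
  obtain ⟨u, rfl⟩ := (Matrix.mulVec_surjective_iff_isUnit.mpr (isUnit_invSqrt hS)) z
  have h1 := h (WithLp.toLp 2 u)
  have h2 : ‖WithLp.toLp 2 u‖ ^ 2 = (invSqrt S *ᵥ u) ⬝ᵥ S *ᵥ (invSqrt S *ᵥ u) := by
    rw [← dotProduct_whiten_mulVec, whiten_self hS, Matrix.one_mulVec, EuclideanSpace.norm_sq_eq]
    simp [dotProduct, sq]
  have h3 := dotProduct_empSecondMoment_mulVec v (WithLp.toLp 2 (invSqrt S *ᵥ u))
  simp only [inner_toEuclideanLin, invSqrt_transpose, Matrix.toLpLin_toLp, Matrix.toLin'_apply,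
    h2] at h1
  rw [← h3] at h1
  exact h1

/-- If the empirical second-moment matrix is within relative error `t < 1` of `S`, the whitened
matrix lies between `(1 + t)⁻²` and `(1 - t)⁻²`. -/
lemma whiten_bounds {A S : Matrix (Fin d) (Fin d) ℝ} (hS : S.PosDef) (hA : A.IsHermitian) {t : ℝ}
    (ht0 : 0 ≤ t) (ht1 : t < 1)
    (h : ∀ z : Fin d → ℝ, |z ⬝ᵥ A *ᵥ z - z ⬝ᵥ S *ᵥ z| ≤ t * (z ⬝ᵥ S *ᵥ z)) :
    A.PosDef ∧ (1 / (1 + t) ^ 2) • (1 : Matrix (Fin d) (Fin d) ℝ) ≤ whiten A S ∧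
      whiten A S ≤ (1 / (1 - t) ^ 2) • (1 : Matrix (Fin d) (Fin d) ℝ) := by
  have hpos : ∀ z : Fin d → ℝ, 0 ≤ z ⬝ᵥ S *ᵥ z := fun z => by
    simpa using hS.posSemidef.dotProduct_mulVec_nonneg z
  have ht : 0 < 1 - t := by linarith
  have hAp : A.PosDef := posDef_of_mul_le hS hA ht fun z => by
    linarith [(abs_le.mp (h z)).1]
  refine ⟨hAp, smul_one_le_whiten hAp hS.isHermitian fun z => ?_,
    whiten_le_smul_one hAp hS.isHermitian fun z => ?_⟩
  -- The squares enter only by weakening: `1 + t ≤ (1 + t) ^ 2` here, `(1 - t) ^ 2 ≤ 1 - t` below.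
  · have h1 := (abs_le.mp (h z)).2
    rw [one_div_mul_eq_div, div_le_iff₀ (by positivity)]
    nlinarith [hpos z, mul_nonneg ht0 (hpos z), mul_nonneg (mul_nonneg ht0 ht0) (hpos z)]
  · have h1 := (abs_le.mp (h z)).1
    rw [one_div_mul_eq_div, le_div_iff₀ (by positivity)]
    nlinarith [hpos z, mul_nonneg ht0 (hpos z), mul_nonneg (mul_nonneg ht0 ht.le) (hpos z)]

end Loewner

/-! ### Choice of the constant `64 (K + 1) ^ 2`. -/

section Constants

/-- The exponent is `-4 s ^ 2`, since `64 ^ 2 / 1024 = 4`: its part `4 d` beats `25 ^ d` because `25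
≤ exp 4`, and the rest yields `η`. -/
lemma pow_mul_exp_neg_le (d : ℕ) {s η a : ℝ} (ha : 0 < a) (hη0 : 0 < η) (hη1 : η < 1)
    (hs : d + Real.log (1 / η) ≤ s ^ 2) :
    25 ^ d * Real.exp (-((64 * a ^ 2 * s) ^ 2 / (1024 * a ^ 4))) ≤ η := by
  have hlog : 0 ≤ Real.log (1 / η) := Real.log_nonneg (by rw [le_div_iff₀ hη0]; linarith)
  have h25 : (25 : ℝ) ≤ Real.exp 4 := by
    have h1 : (2.7 : ℝ) ≤ Real.exp 1 := by linarith [Real.exp_one_gt_d9]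
    have h2 : Real.exp 4 = Real.exp 1 ^ 4 := by rw [← Real.exp_nat_mul]; norm_num
    rw [h2]
    calc (25 : ℝ) ≤ 2.7 ^ 4 := by norm_num
      _ ≤ _ := by gcongr
  have he : (64 * a ^ 2 * s) ^ 2 / (1024 * a ^ 4) = 4 * s ^ 2 := by field_simp; norm_num; ring
  calc 25 ^ d * Real.exp (-((64 * a ^ 2 * s) ^ 2 / (1024 * a ^ 4)))
      ≤ Real.exp 4 ^ d * Real.exp (-(d * 4) - Real.log (1 / η)) := by
        rw [he]
        gcongr
        linarith
    _ = η := by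
      rw [← Real.exp_nat_mul, ← Real.exp_add, one_div, Real.log_inv]
      simp [Real.exp_log hη0]

lemma div_add_sq_eq {x : ℝ} (n : ℕ) (hn : 0 < √(n : ℝ)) (hx : √(n : ℝ) + x ≠ 0) :
    n / (√(n : ℝ) + x) ^ 2 = 1 / (1 + x / √(n : ℝ)) ^ 2 := by
  have h : 1 + x / √(n : ℝ) = (√(n : ℝ) + x) / √(n : ℝ) := by field_simp
  rw [h, div_pow, one_div_div, Real.sq_sqrt n.cast_nonneg]

end Constants

/-! ### Assembly for a general positive definite second moment. -/

section Sample

variable {Ω : Type*} [MeasurableSpace Ω] {μ : Measure Ω} [IsProbabilityMeasure μ] {d n : ℕ}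
  {K : ℝ≥0}

theorem exists_measurableSet_forall_whiten_bounds {S : Matrix (Fin d) (Fin d) ℝ} (hS : S.PosDef)
    {P : Measure (EuclideanSpace ℝ (Fin d))} (hP : IsSubG K S P)
    {υ : Fin n → Ω → EuclideanSpace ℝ (Fin d)} (hυ : ∀ i, HasLaw (υ i) P μ)
    (hind : iIndepFun υ μ) {η : ℝ} (hη0 : 0 < η) (hη1 : η < 1)
    (hn : 64 * ((K : ℝ) + 1) ^ 2 * (√d + √(Real.log (1 / η))) < √n) :
    ∃ E : Set Ω, MeasurableSet E ∧ 1 - 2 * η ≤ μ.real E ∧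
      ∀ ω ∈ E, (empSecondMoment fun i => υ i ω).PosDef ∧
        lowerBound (64 * ((K : ℝ) + 1) ^ 2) n d η • (1 : Matrix (Fin d) (Fin d) ℝ)
          ≤ whiten (empSecondMoment fun i => υ i ω) S ∧
        whiten (empSecondMoment fun i => υ i ω) S
          ≤ upperBound (64 * ((K : ℝ) + 1) ^ 2) n d η • (1 : Matrix (Fin d) (Fin d) ℝ) := by
  set s : ℝ := √d + √(Real.log (1 / η)) with hs
  set x : ℝ := 64 * ((K : ℝ) + 1) ^ 2 * s with hx
  have hs0 : 0 ≤ s := by positivity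
  have hx0 : 0 ≤ x := by positivity
  have hsqrt : 0 < √(n : ℝ) := hx0.trans_lt hn
  have hn0 : 0 < n := by exact_mod_cast Real.sqrt_pos.mp hsqrt
  have ht0 : 0 ≤ x / √n := by positivity
  have ht1 : x / √n < 1 := (div_lt_one hsqrt).mpr hn
  have hP' : IsSubG K 1 (P.map (Matrix.toEuclideanLin (invSqrt S))) := by
    have h := hP.map (invSqrt S)
    rwa [invSqrt_transpose, show invSqrt S * S * invSqrt S = 1 from whiten_self hS] at h
  have hR : Measurable (Matrix.toEuclideanLin (invSqrt S)) :=
    (LinearMap.continuous_of_finiteDimensional _).measurable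
  obtain ⟨E, hE, hμE, hbound⟩ := exists_measurableSet_forall_abs_empirical_sub_le hP'
    (w := fun i ω => Matrix.toEuclideanLin (invSqrt S) (υ i ω))
    (fun i => ⟨hR.comp_aemeasurable (hυ i).aemeasurable, by
      rw [← (hυ i).map_eq, AEMeasurable.map_map_of_aemeasurable hR.aemeasurable
        (hυ i).aemeasurable]
      rfl⟩)
    (hind.comp (fun _ => Matrix.toEuclideanLin (invSqrt S)) fun _ => hR) hn0 ht0 ht1.le
  refine ⟨E, hE, le_trans ?_ hμE, fun ω hω => ?_⟩
  -- Expand the square and drop the nonnegative cross term.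
  · have hs2 : d + Real.log (1 / η) ≤ s ^ 2 := by
      have hlog : 0 ≤ Real.log (1 / η) := Real.log_nonneg (by rw [le_div_iff₀ hη0]; linarith)
      have := mul_nonneg (Real.sqrt_nonneg (d : ℝ)) (Real.sqrt_nonneg (Real.log (1 / η)))
      rw [hs, add_sq, Real.sq_sqrt d.cast_nonneg, Real.sq_sqrt hlog]
      linarith
    have hnt : n * (x / √n) ^ 2 = x ^ 2 := by
      rw [div_pow, Real.sq_sqrt n.cast_nonneg]
      field_simp
    have := pow_mul_exp_neg_le d (a := (K : ℝ) + 1) (by positivity) hη0 hη1 hs2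
    rw [hnt]
    linarith
  · have h := whiten_bounds hS (empSecondMoment_posSemidef fun i => υ i ω).isHermitian ht0 ht1
      (abs_empSecondMoment_sub_le hS _ (hbound ω hω))
    have hL : lowerBound (64 * ((K : ℝ) + 1) ^ 2) n d η = 1 / (1 + x / √n) ^ 2 :=
      div_add_sq_eq n hsqrt (by positivity)
    have hU : upperBound (64 * ((K : ℝ) + 1) ^ 2) n d η = 1 / (1 - x / √n) ^ 2 := by
      have := div_add_sq_eq (x := -x) n hsqrt (by linarith)
      rwa [neg_div, ← sub_eq_add_neg, ← sub_eq_add_neg] at this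
    rwa [hL, hU]

end Sample

end SecondMoment

theorem theorem3p1 (K : ℝ≥0) :
    ∃ C : ℝ, 0 < C ∧
      ∀ (d n : ℕ) (S : Matrix (Fin d) (Fin d) ℝ), S.PosDef →
      ∀ (Ω : Type*) [MeasurableSpace Ω] (μ : Measure Ω) [IsProbabilityMeasure μ]
        (P : Measure (EuclideanSpace ℝ (Fin d))), SecondMoment.IsSubG K S P →
      ∀ υ : Fin n → Ω → EuclideanSpace ℝ (Fin d),
        (∀ i, HasLaw (υ i) P μ) → iIndepFun υ μ →
        -- conditionally on the sample, the whitened vector is `subG` of the whitened matrix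
        (∀ (K' : ℝ≥0) (ξ : Ω → EuclideanSpace ℝ (Fin d)),
          AEMeasurable ξ μ → SecondMoment.IsSubG K' S (μ.map ξ) →
          IndepFun ξ (fun ω i => υ i ω) μ →
          ∀ᵐ ω ∂μ, (SecondMoment.empSecondMoment fun i => υ i ω).PosDef →
            SecondMoment.IsSubG K'
              (SecondMoment.whiten (SecondMoment.empSecondMoment fun i => υ i ω) S)
              (condDistrib
                (fun ω' => Matrix.toEuclideanLin
                  (SecondMoment.invSqrt (SecondMoment.empSecondMoment fun i => υ i ω')) (ξ ω'))
                (fun ω' i => υ i ω') μ (fun i => υ i ω))) ∧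
        -- the two-sided bound with probability at least `1 - 2η`
        (∀ η : ℝ, 0 < η → η < 1 →
          C * (√d + √(Real.log (1 / η))) < √n →
          ∃ E : Set Ω, MeasurableSet E ∧ 1 - 2 * η ≤ μ.real E ∧
            ∀ ω ∈ E, (SecondMoment.empSecondMoment fun i => υ i ω).PosDef ∧
              SecondMoment.lowerBound C n d η • (1 : Matrix (Fin d) (Fin d) ℝ)
                ≤ SecondMoment.whiten (SecondMoment.empSecondMoment fun i => υ i ω) S ∧
              SecondMoment.whiten (SecondMoment.empSecondMoment fun i => υ i ω) S
                ≤ SecondMoment.upperBound C n d η • (1 : Matrix (Fin d) (Fin d) ℝ)) := by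
  refine ⟨64 * ((K : ℝ) + 1) ^ 2, by positivity, fun d n S hS Ω _ μ _ P hP υ hυ hind =>
    ⟨fun K' ξ hξ hSξ hindξ => ?_, fun η hη0 hη1 hn => ?_⟩⟩
  · filter_upwards [SecondMoment.ae_isSubG_condDistrib_whiten
      (aemeasurable_pi_lambda _ fun i => (hυ i).aemeasurable) hξ hSξ hindξ] with ω hω _
    exact hω
  · exact SecondMoment.exists_measurableSet_forall_whiten_bounds hS hP hυ hind hη0 hη1 hn
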